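/- **Setting.** A table has finitely many numerical attributes and arbitrary categorical attributes, with publicly known domains. The domain $\mathrm{dom}_j\subset\mathbb R$ of the numerical attribute $j$ is contained in a public interval $[\ell_j,h_j]$. A dataset $D$ is a finite multiset of records; $D[j]$ is the multiset of the values of attribute $j$. Two datasets are neighboring if one arises from the other by adding one record. For $\alpha>1$, a randomized algorithm $\mathcal A$ is $(\alpha,\varepsilon)$-Rényi differentially private if for all neighboring $D,D'$ (in either order) $$D_\alpha(\mathcal A(D)\,\|\,\mathcal A(D'))=\frac1{\alpha-1}\ln \mathbb E_{x\sim\mathcal A(D')}\Big[\Big(\tfrac{\mathcal A(D)(x)}{\mathcal A(D')(x)}\Big)^{\alpha}\Big]\le\varepsilon ,$$ where the ratio is the Radon–Nikodym density and $D_\alpha=+\infty$ if the law of $\mathcal A(D)$ is not absolutely continuous with respect to that of $\mathcal A(D')$. **PrivTree**$(X,\lambda,\delta,\theta)$, for a finite multiset $X$ of reals and an interval $[\ell,h]$. Start with a tree consisting of the unvisited root, whose subdomain is $[\ell,h]$ and whose depth is $0$. As long as there is an unvisited node $v$, mark it visited, let $c(v)$ be the number of elements of $X$ in its subdomain, put $b(v)=\max\{c(v)-\mathrm{depth}(v)\,\delta,\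 \theta-\delta\}$, and draw fresh independent Laplace noise $\mathrm{Lap}(\lambda)$ (density $\frac1{2\lambda}e^{-|x|/\lambda}$). If $b(v)+\mathrm{Lap}(\lambda)>\theta$, split $v$: bisect its subdomain at the midpoint and add the two halves as unvisited children. The output is the tree, without the counts. **PrivTree Binning**, with parameters $\beta\in\mathbb N$, $\theta\in\mathbb R$ and $\rho_1>0$. Let $V_n$ be the set of the numerical attributes $j$ with $|\mathrm{dom}_j|\ge\beta$, and put $$\beta_0=2,\qquad \lambda'=\frac{2\beta_0-1}{\beta_0-1}\sqrt{\frac{|V_n|}{2\rho_1}},\qquad \delta'=\lambda'\ln\beta_0 .$$ For each $j\in V_n$ run PrivTree$(D[j],\lambda',\delta',\theta)$ on $[\ell_j,h_j]$, with independent noise for different $j$, and let $T$ be the family of the resulting trees. $T$ provides the bins with which the dataset is discretized, and it is the output whose privacy is considered. **Lemma.** For every $\alpha>1$, PrivTree Binning, that is, the release of $T$, satisfies $(\alpha,\alpha\rho_1)$-Rényi differential privacy. -/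

import Mathlib

open MeasureTheory

universe u v w

noncomputable section

namespace PrivTreeBinning

/-! ### Rényi divergence -/

/-- The Rényi divergence `D_α(P ‖ Q) = (α - 1)⁻¹ ln E_{x ∼ Q} [(P(x) / Q(x)) ^ α]`, with
`P(x) / Q(x)` the Radon-Nikodym density; it is `+∞` if `P` is not absolutely continuous
with respect to `Q`. -/
def renyiDiv {Ω : Type*} [MeasurableSpace Ω] (α : ℝ) (P Q : Measure Ω) : EReal :=
  open Classical in
  if P ≪ Q then
    (((α - 1)⁻¹ : ℝ) : EReal) * ENNReal.log (∫⁻ x, (P.rnDeriv Q x) ^ α ∂Q)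
  else ⊤

/-! ### Laplace noise -/

/-- The centred Laplace distribution with scale `b`, of density `exp (-|x| / b) / (2 b)`
(the point mass at `0` if the scale is not positive). -/
def laplace (b : ℝ) : Measure ℝ :=
  open Classical in
  if 0 < b then
    volume.withDensity fun x => ENNReal.ofReal (1 / (2 * b) * Real.exp (-|x| / b))
  else Measure.dirac 0

instance isProbabilityMeasure_laplace (b : ℝ) : IsProbabilityMeasure (laplace b) := by
  unfold laplace
  split_ifs with hb
  · constructor
    have hI : ∫ x : ℝ, 1 / (2 * b) * Real.exp (-|x| / b) = 1 := by
      rw [integral_comp_abs (f := fun x => 1 / (2 * b) * Real.exp (-x / b)),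
        integral_const_mul]
      have h : ∀ x : ℝ, Real.exp (-x / b) = Real.exp ((-1 / b) * x) := fun x => by
        congr 1; ring
      simp_rw [h]
      rw [integral_exp_mul_Ioi (div_neg_of_neg_of_pos (by norm_num) hb)]
      simp
      field_simp
    have hint : Integrable (fun x : ℝ => 1 / (2 * b) * Real.exp (-|x| / b)) := by
      by_contra h
      rw [integral_undef h] at hI
      exact zero_ne_one hI
    rw [withDensity_apply _ .univ, setLIntegral_univ,
      ← ofReal_integral_eq_lintegral_ofReal hint
        (Filter.Eventually.of_forall fun x => by positivity), hI, ENNReal.ofReal_one]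
  · infer_instance

/-! ### PrivTree on one numerical attribute

A node of the infinite binary decomposition tree of an interval is the list of the turns
that lead to it from the root, the last turn first (`false`: lower half, `true`: upper half).
The root is `[]`, the children of `v` are `false :: v` and `true :: v`, and the depth of `v` is
its length. -/

/-- End points of the interval of the node `v`, when the root is `[lo, hi]` and every split
bisects. -/
def bounds (lo hi : ℝ) : List Bool → ℝ × ℝ
  | [] => (lo, hi)
  | false :: v => ((bounds lo hi v).1, ((bounds lo hi v).1 + (bounds lo hi v).2) / 2)
  | true :: v => (((bounds lo hi v).1 + (bounds lo hi v).2) / 2, (bounds lo hi v).2)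

/-- The subdomain of the node `v`: the root has `[lo, hi]`, and the children of `v` have
the points of `v` that lie strictly below the midpoint, and the other ones. -/
def cell (lo hi : ℝ) : List Bool → Set ℝ
  | [] => Set.Icc lo hi
  | false :: v =>
    cell lo hi v ∩ Set.Iio (((bounds lo hi v).1 + (bounds lo hi v).2) / 2)
  | true :: v =>
    cell lo hi v ∩ Set.Ici (((bounds lo hi v).1 + (bounds lo hi v).2) / 2)

/-- The number `c(v)` of the values in `X` that lie in the subdomain of `v`. -/
def count (lo hi : ℝ) (X : Multiset ℝ) (v : List Bool) : ℕ :=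
  open Classical in X.countP (· ∈ cell lo hi v)

/-- The biased count `b(v) = max (c(v) - depth(v) δ, θ - δ)`. -/
def biasedCount (lo hi δ θ : ℝ) (X : Multiset ℝ) (v : List Bool) : ℝ :=
  max ((count lo hi X v : ℝ) - v.length * δ) (θ - δ)

/-- `v` is a node of the tree that PrivTree builds when `noise u` is the noise drawn at
the node `u`: the root is one, and the children of a node `v` of the tree belong to the tree
if and only if `v` is split, that is, its noisy biased count exceeds `θ`. -/
def InTree (lo hi δ θ : ℝ) (X : Multiset ℝ) (noise : List Bool → ℝ) : List Bool → Prop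
  | [] => True
  | _ :: v => InTree lo hi δ θ X noise v ∧ θ < biasedCount lo hi δ θ X v + noise v

/-- The tree (as its set of nodes, without any counts) that PrivTree returns. -/
def treeOf (lo hi δ θ : ℝ) (X : Multiset ℝ) (noise : List Bool → ℝ) : Set (List Bool) :=
  {v | InTree lo hi δ θ X noise v}

lemma measurable_treeOf (lo hi δ θ : ℝ) (X : Multiset ℝ) :
    Measurable (treeOf lo hi δ θ X) := by
  rw [measurable_set_iff]
  intro v
  change Measurable fun noise => InTree lo hi δ θ X noise v
  induction v with
  | nil => exact measurable_const
  | cons b v ih =>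
    refine Measurable.and ih ?_
    refine measurableSet_setOfPred.1 (measurableSet_lt measurable_const ?_)
    fun_prop

/-- PrivTree with noise scale `lam`, decay `δ` and threshold `θ`, run on the values `X` in
the domain `[lo, hi]`: the law of the returned tree when the noises at the nodes are
independent Laplace variables of scale `lam`. -/
def privTree (lo hi lam δ θ : ℝ) (X : Multiset ℝ) : Measure (Set (List Bool)) :=
  (Measure.infinitePi fun _ : List Bool => laplace lam).map (treeOf lo hi δ θ X)

instance isProbabilityMeasure_privTree (lo hi lam δ θ : ℝ) (X : Multiset ℝ) :
    IsProbabilityMeasure (privTree lo hi lam δ θ X) :=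
  Measure.isProbabilityMeasure_map (measurable_treeOf lo hi δ θ X).aemeasurable

/-! ### Tables -/

/-- The public description of a table with numerical attributes `ι` and categorical
attributes `κ`: the domain `dom j` of each numerical attribute, with an interval
`[lo j, hi j]` that contains it, and the domain `cat k` of each categorical attribute. -/
structure Schema (ι : Type u) (κ : Type v) where
  dom : ι → Set ℝ
  lo : ι → ℝ
  hi : ι → ℝ
  dom_subset : ∀ j, dom j ⊆ Set.Icc (lo j) (hi j)
  cat : κ → Type w

variable {ι : Type u} {κ : Type v}

/-- A record: one value in the domain of each attribute. -/
structure Record (S : Schema.{u, v, w} ι κ) where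
  num : ∀ j, S.dom j
  cat : ∀ k, S.cat k

/-- A dataset is a finite collection of records, repetitions allowed. -/
abbrev Dataset (S : Schema.{u, v, w} ι κ) := Multiset (Record S)

/-- Neighbouring datasets: one has exactly one record more than the other. -/
def Neighbor {S : Schema.{u, v, w} ι κ} (D D' : Dataset S) : Prop :=
  ∃ r : Record S, D' = r ::ₘ D ∨ D = r ::ₘ D'

/-- The column `D[j]`. -/
def column {S : Schema.{u, v, w} ι κ} (D : Dataset S) (j : ι) : Multiset ℝ :=
  D.map fun r => (r.num j : ℝ)

/-! ### PrivTree Binning -/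

/-- `V_n`: the numerical attributes whose domain has at least `β` elements. -/
def largeNum [Fintype ι] (S : Schema.{u, v, w} ι κ) (β : ℕ) : Finset ι :=
  open Classical in Finset.univ.filter fun j => (β : ℕ∞) ≤ (S.dom j).encard

/-- The fan-out of the decomposition trees. -/
def beta0 : ℝ := 2

/-- `λ' = (2 β₀ - 1) / (β₀ - 1) * √(|V_n| / (2 ρ₁))`. -/
def noiseScale [Fintype ι] (S : Schema.{u, v, w} ι κ) (β : ℕ) (ρ₁ : ℝ) : ℝ :=
  (2 * beta0 - 1) / (beta0 - 1) * √(((largeNum S β).card : ℝ) / (2 * ρ₁))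

/-- `δ' = λ' ln β₀`. -/
def decay [Fintype ι] (S : Schema.{u, v, w} ι κ) (β : ℕ) (ρ₁ : ℝ) : ℝ :=
  noiseScale S β ρ₁ * Real.log beta0

/-- PrivTree Binning: the joint law of the trees found for the attributes in `V_n`, the runs
of PrivTree on the columns using independent noise. These trees are what the algorithm
learns from the data; they are the bins with which the dataset is then discretized. -/
def privTreeBinning [Fintype ι] (S : Schema.{u, v, w} ι κ) (β : ℕ) (θ ρ₁ : ℝ)
    (D : Dataset S) : Measure (largeNum S β → Set (List Bool)) :=
  Measure.pi fun j : largeNum S β =>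
    privTree (S.lo j) (S.hi j) (noiseScale S β ρ₁) (decay S β ρ₁) θ (column D j)

instance isProbabilityMeasure_privTreeBinning [Fintype ι] (S : Schema.{u, v, w} ι κ) (β : ℕ)
    (θ ρ₁ : ℝ) (D : Dataset S) : IsProbabilityMeasure (privTreeBinning S β θ ρ₁ D) := by
  unfold privTreeBinning; infer_instance

/-- A randomized algorithm on datasets, given by the laws of its output, is
`(α, ε)`-Rényi differentially private. -/
def IsRDP {S : Schema.{u, v, w} ι κ} {Ω : Type*} [MeasurableSpace Ω]
    (A : Dataset S → Measure Ω) (α ε : ℝ) : Prop :=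
  ∀ D D' : Dataset S, Neighbor D D' → renyiDiv α (A D) (A D') ≤ (ε : EReal)

end PrivTreeBinning

end

noncomputable section

namespace PrivTreeBinning

/-! ### Rényi divergence of measures with a bounded likelihood ratio -/

/-! One PrivTree run with noise scale `λ` and decay `λ log 2` has likelihood ratio in `[exp (-3/λ),
exp (3/λ)]` when one value is added (`hasBoundedRatio_privTree_cons`). A density confined to `[exp
(-ε), exp ε]` costs at most `α ε² / 2` in Rényi divergence, and these costs add over independent
runs (`renyiDiv_pi_le`). With `ε = 3/λ'` and `λ' = 3 √(|V_n| / (2 ρ₁))` the total is `|V_n| · α · 9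
/ (2 λ'²) = α ρ₁`.

For one run, a new value `x` changes only the counts of the cells that contain `x`, and these form a
descending chain. The density of the new tree law is the product over the chain of the ratios of the
split or no-split probabilities (`treeLaw_piecewise`). Every split probability grows, so the only
factor below 1 comes from the leaf where the chain leaves the tree; it is at least `exp (-1/λ)`. For
the upper bound, the rescaled scores `a v = (c(v) - depth(v) δ - θ) / λ` drop by at least `log 2` at
each step of the chain and are all shifted by `1/λ`. The logarithm of the split probability has
slope 0 below `-log 2`, 1 on `[-log 2, 0)` and at most `exp (-a)` from 0 on. Separated scores
therefore have total slope at most `1 + (1 + 1/2 + 1/4 + ...) = 3` (`sum_slopeBound_le`), and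
integrating over the shift gives `3/λ`. -/

lemma sinh_le_mul_cosh {y : ℝ} (hy : 0 ≤ y) : Real.sinh y ≤ y * Real.cosh y := by
  have h : MonotoneOn (fun y : ℝ => y * Real.cosh y - Real.sinh y) (Set.Ici 0) := by
    refine monotoneOn_of_hasDerivWithinAt_nonneg (f' := fun y => y * Real.sinh y)
      (convex_Ici 0) (by fun_prop) (fun x _ => ?_) fun x hx => ?_
    · refine HasDerivAt.hasDerivWithinAt ?_
      refine (((hasDerivAt_id x).mul (Real.hasDerivAt_cosh x)).sub
        (Real.hasDerivAt_sinh x)).congr_deriv ?_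
      simp
    · rw [interior_Ici, Set.mem_Ioi] at hx
      exact mul_nonneg hx.le (Real.sinh_nonneg_iff.2 hx.le)
  have := h (Set.mem_Ici.2 le_rfl) (Set.mem_Ici.2 hy) hy
  simp at this
  linarith

lemma antitoneOn_cosh_mul_exp :
    AntitoneOn (fun y : ℝ => Real.cosh y * Real.exp (-(y ^ 2 / 2))) (Set.Ici 0) := by
  refine antitoneOn_of_hasDerivWithinAt_nonpos
    (f' := fun y => (Real.sinh y - y * Real.cosh y) * Real.exp (-(y ^ 2 / 2)))
    (convex_Ici 0) (by fun_prop) (fun x _ => ?_) fun x hx => ?_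
  · refine HasDerivAt.hasDerivWithinAt ?_
    have h : HasDerivAt (fun y : ℝ => Real.exp (-(y ^ 2 / 2)))
        (Real.exp (-(x ^ 2 / 2)) * (-x)) x := by
      refine ((((hasDerivAt_id x).pow 2).div_const 2).neg.exp).congr_deriv ?_
      simp
    refine ((Real.hasDerivAt_cosh x).mul h).congr_deriv ?_
    ring
  · rw [interior_Ici, Set.mem_Ioi] at hx
    exact mul_nonpos_of_nonpos_of_nonneg (by linarith [sinh_le_mul_cosh hx.le])
      (Real.exp_pos _).le

/-- Half-angle formulas turn the quotient by `sinh ε` into `cosh ((2α - 1) ε/2) / cosh (ε/2)`. Since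
`cosh y * exp (-y²/2)` decreases on `y ≥ 0`, this is at most the exponential of `((2α - 1)² - 1) ε²
/ 8 = (α - 1) α ε² / 2`. -/
lemma sinh_mul_sub_sinh_le {α ε : ℝ} (hα : 1 < α) (hε : 0 < ε) :
    Real.sinh (α * ε) - Real.sinh ((α - 1) * ε) ≤
      Real.sinh ε * Real.exp ((α - 1) * (α * ε ^ 2 / 2)) := by
  have hs : 0 < Real.sinh (ε / 2) := Real.sinh_pos_iff.2 (by positivity)
  have h := antitoneOn_cosh_mul_exp (Set.mem_Ici.2 (by positivity : (0 : ℝ) ≤ ε / 2))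
    (Set.mem_Ici.2 (by nlinarith : 0 ≤ (2 * α - 1) * (ε / 2)))
    (by nlinarith : ε / 2 ≤ (2 * α - 1) * (ε / 2))
  have h1 : Real.cosh ((2 * α - 1) * (ε / 2)) ≤
      Real.cosh (ε / 2) * Real.exp ((α - 1) * (α * ε ^ 2 / 2)) := by
    have h2 := mul_le_mul_of_nonneg_right h
      (Real.exp_pos (((2 * α - 1) * (ε / 2)) ^ 2 / 2)).le
    simp only [mul_assoc, ← Real.exp_add, neg_add_cancel, Real.exp_zero, mul_one] at h2
    rwa [show (α - 1) * (α * ε ^ 2 / 2) =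
      -((ε / 2) ^ 2 / 2) + ((2 * α - 1) * (ε / 2)) ^ 2 / 2 by ring]
  have e1 : Real.sinh (α * ε) - Real.sinh ((α - 1) * ε) =
      2 * Real.sinh (ε / 2) * Real.cosh ((2 * α - 1) * (ε / 2)) := by
    rw [show α * ε = (2 * α - 1) * (ε / 2) + ε / 2 by ring,
      show (α - 1) * ε = (2 * α - 1) * (ε / 2) - ε / 2 by ring, Real.sinh_add, Real.sinh_sub]
    ring
  have e2 : Real.sinh ε = 2 * Real.sinh (ε / 2) * Real.cosh (ε / 2) := by
    rw [← Real.sinh_two_mul, mul_div_cancel₀ ε two_ne_zero]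
  rw [e1, e2, mul_assoc _ (Real.cosh _)]
  exact mul_le_mul_of_nonneg_left h1 (by positivity)

/-- Convexity of `x ^ α`: on the interval the graph lies below the chord through the end points. -/
lemma rpow_le_chord {α ε x : ℝ} (hα : 1 < α) (hε : 0 < ε)
    (hx : x ∈ Set.Icc (Real.exp (-ε)) (Real.exp ε)) :
    x ^ α ≤ -Real.sinh ((α - 1) * ε) / Real.sinh ε + Real.sinh (α * ε) / Real.sinh ε * x := by
  have hs : 0 < Real.sinh ε := Real.sinh_pos_iff.2 hε
  have hd : Real.exp ε - Real.exp (-ε) = 2 * Real.sinh ε := by rw [Real.sinh_eq]; ring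
  have h := (convexOn_rpow hα.le).2 (Set.mem_Ici.2 (Real.exp_pos (-ε)).le)
    (Set.mem_Ici.2 (Real.exp_pos ε).le)
    (div_nonneg (sub_nonneg.2 hx.2) (by positivity : 0 ≤ 2 * Real.sinh ε))
    (div_nonneg (sub_nonneg.2 hx.1) (by positivity : 0 ≤ 2 * Real.sinh ε))
    (by rw [← add_div, sub_add_sub_cancel, hd, div_self (by positivity)])
  simp only [smul_eq_mul, ← Real.exp_mul] at h
  have e : (Real.exp ε - x) / (2 * Real.sinh ε) * Real.exp (-ε) +
      (x - Real.exp (-ε)) / (2 * Real.sinh ε) * Real.exp ε = x := by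
    rw [div_mul_eq_mul_div, div_mul_eq_mul_div, ← add_div, div_eq_iff (by positivity), ← hd]
    ring
  rw [e] at h
  refine h.trans_eq ?_
  have e1 : Real.sinh (α * ε) = (Real.exp (ε * α) - Real.exp (-ε * α)) / 2 := by
    rw [Real.sinh_eq]; ring_nf
  have e2 : Real.sinh ((α - 1) * ε) =
      (Real.exp (ε * α) * Real.exp (-ε) - Real.exp (-ε * α) * Real.exp ε) / 2 := by
    rw [Real.sinh_eq, ← Real.exp_add, ← Real.exp_add]; ring_nf
  rw [e1, e2]
  field_simp
  ring

/-- `P` has with respect to `Q` a density with values in `[exp (-ε), exp ε]`. -/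
def HasBoundedRatio {Ω : Type*} [MeasurableSpace Ω] (ε : ℝ) (P Q : Measure Ω) : Prop :=
  ∃ f : Ω → ℝ, Measurable f ∧ (∀ᵐ x ∂Q, f x ∈ Set.Icc (Real.exp (-ε)) (Real.exp ε)) ∧
    P = Q.withDensity fun x => ENNReal.ofReal (f x)

lemma HasBoundedRatio.symm {Ω : Type*} [MeasurableSpace Ω] {ε : ℝ} {P Q : Measure Ω}
    (h : HasBoundedRatio ε P Q) : HasBoundedRatio ε Q P := by
  obtain ⟨f, hf, hb, rfl⟩ := h
  refine ⟨fun x => (f x)⁻¹, hf.inv, ?_, ?_⟩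
  · refine (withDensity_absolutelyContinuous Q _) (hb.mono fun x hx => ?_)
    have h0 : 0 < f x := (Real.exp_pos _).trans_le hx.1
    constructor
    · rw [Real.exp_neg]
      exact inv_anti₀ h0 hx.2
    · rw [← neg_neg ε, Real.exp_neg (-ε)]
      exact inv_anti₀ (Real.exp_pos _) hx.1
  · have h1 := withDensity_inv_same₀ (μ := Q) (f := fun x => ENNReal.ofReal (f x))
      (by fun_prop)
      (hb.mono fun x hx => by simpa using (Real.exp_pos _).trans_le hx.1)
      (Filter.Eventually.of_forall fun x => ENNReal.ofReal_ne_top)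
    conv_lhs => rw [← h1]
    refine withDensity_congr_ae ?_
    refine (withDensity_absolutelyContinuous Q _) (hb.mono fun x hx => ?_)
    exact (ENNReal.ofReal_inv_of_pos ((Real.exp_pos _).trans_le hx.1)).symm

/-- The chord bound is affine in `f`, so its integral depends only on the mean of `f`, which is 1.
What remains is the value `A + B` of the chord at 1. -/
lemma lintegral_rpow_le_of_mem_Icc {Ω : Type*} [MeasurableSpace Ω] {Q : Measure Ω}
    [IsProbabilityMeasure Q] {α ε : ℝ} (hα : 1 < α) (hε : 0 < ε) {f : Ω → ℝ}
    (hf : Measurable f) (hb : ∀ᵐ x ∂Q, f x ∈ Set.Icc (Real.exp (-ε)) (Real.exp ε))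
    (h1 : ∫⁻ x, ENNReal.ofReal (f x) ∂Q = 1) :
    ∫⁻ x, ENNReal.ofReal (f x) ^ α ∂Q ≤
      ENNReal.ofReal (Real.exp ((α - 1) * (α * ε ^ 2 / 2))) := by
  have hs : 0 < Real.sinh ε := Real.sinh_pos_iff.2 hε
  have h0 : ∀ᵐ x ∂Q, 0 ≤ f x := hb.mono fun x hx => (Real.exp_pos _).le.trans hx.1
  have hI : Integrable f Q := by
    refine ⟨hf.aestronglyMeasurable, ?_⟩
    rw [hasFiniteIntegral_iff_ofReal h0, h1]
    exact ENNReal.one_lt_top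
  have hI1 : ∫ x, f x ∂Q = 1 := by
    rw [integral_eq_lintegral_of_nonneg_ae h0 hf.aestronglyMeasurable, h1, ENNReal.toReal_one]
  set A := -Real.sinh ((α - 1) * ε) / Real.sinh ε
  set B := Real.sinh (α * ε) / Real.sinh ε
  calc ∫⁻ x, ENNReal.ofReal (f x) ^ α ∂Q
      ≤ ∫⁻ x, ENNReal.ofReal (A + B * f x) ∂Q := by
        refine lintegral_mono_ae ?_
        filter_upwards [hb, h0] with x hx hx0
        rw [ENNReal.ofReal_rpow_of_nonneg hx0 (by linarith)]
        exact ENNReal.ofReal_le_ofReal (rpow_le_chord hα hε hx)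
    _ = ENNReal.ofReal (∫ x, (A + B * f x) ∂Q) := by
        refine (ofReal_integral_eq_lintegral_ofReal
          ((integrable_const A).add (hI.const_mul B)) ?_).symm
        filter_upwards [hb, h0] with x hx hx0
        exact (Real.rpow_nonneg hx0 α).trans (rpow_le_chord hα hε hx)
    _ = ENNReal.ofReal (A + B) := by
        rw [integral_add (integrable_const A) (hI.const_mul B), integral_const_mul, hI1]
        simp
    _ ≤ _ := by
        refine ENNReal.ofReal_le_ofReal ?_
        rw [← add_div, div_le_iff₀ hs]
        linarith [sinh_mul_sub_sinh_le hα hε]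

lemma lintegral_pi_prod {ι : Type*} [Fintype ι] {Ω : ι → Type*} [∀ i, MeasurableSpace (Ω i)]
    (Q : ∀ i, Measure (Ω i)) [∀ i, IsProbabilityMeasure (Q i)] {f : ∀ i, Ω i → ENNReal}
    (hf : ∀ i, Measurable (f i)) :
    ∫⁻ x, ∏ i, f i (x i) ∂Measure.pi Q = ∏ i, ∫⁻ x, f i x ∂Q i := by
  refine (ProbabilityTheory.lintegral_prod_eq_prod_lintegral_of_indepFun Finset.univ
    (fun i (x : ∀ i, Ω i) => f i (x i)) (ProbabilityTheory.iIndepFun_pi fun i => (hf i).aemeasurable)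
    fun i => (hf i).comp (measurable_pi_apply i)).trans ?_
  refine Finset.prod_congr rfl fun i _ => ?_
  exact (measurePreserving_eval Q i).lintegral_comp (hf i)

lemma pi_withDensity {ι : Type*} [Fintype ι] {Ω : ι → Type*} [∀ i, MeasurableSpace (Ω i)]
    (Q : ∀ i, Measure (Ω i)) [∀ i, IsProbabilityMeasure (Q i)] {f : ∀ i, Ω i → ENNReal}
    (hf : ∀ i, Measurable (f i)) [∀ i, SigmaFinite ((Q i).withDensity (f i))] :
    Measure.pi (fun i => (Q i).withDensity (f i)) =
      (Measure.pi Q).withDensity fun x => ∏ i, f i (x i) := by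
  refine Measure.pi_eq fun s hs => ?_
  rw [withDensity_apply _ (MeasurableSet.univ_pi hs),
    ← lintegral_indicator (MeasurableSet.univ_pi hs)]
  have : (Set.univ.pi s).indicator (fun x => ∏ i, f i (x i)) =
      fun x => ∏ i, (s i).indicator (f i) (x i) := by
    ext x
    by_cases hx : x ∈ Set.univ.pi s
    · rw [Set.indicator_of_mem hx]
      exact Finset.prod_congr rfl fun i _ =>
        (Set.indicator_of_mem (hx i (Set.mem_univ i)) _).symm
    · rw [Set.indicator_of_notMem hx]
      simp only [Set.mem_univ_pi, not_forall] at hx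
      obtain ⟨i, hi⟩ := hx
      exact (Finset.prod_eq_zero (Finset.mem_univ i) (Set.indicator_of_notMem hi _)).symm
  rw [this, lintegral_pi_prod Q fun i => (hf i).indicator (hs i)]
  refine Finset.prod_congr rfl fun i _ => ?_
  rw [withDensity_apply _ (hs i), lintegral_indicator (hs i)]

/-- Independent releases whose likelihood ratios lie in `[exp (-ε), exp ε]`: each of them
contributes `α ε ^ 2 / 2` to the Rényi divergence. -/
lemma renyiDiv_pi_le {ι : Type*} [Fintype ι] {Ω : ι → Type*} [∀ i, MeasurableSpace (Ω i)]
    (P Q : ∀ i, Measure (Ω i)) [∀ i, IsProbabilityMeasure (P i)]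
    [∀ i, IsProbabilityMeasure (Q i)] {α ε : ℝ} (hα : 1 < α)
    (hε : Nonempty ι → 0 < ε) (h : ∀ i, HasBoundedRatio ε (P i) (Q i)) :
    renyiDiv α (Measure.pi P) (Measure.pi Q) ≤
      ((Fintype.card ι * (α * ε ^ 2 / 2) : ℝ) : EReal) := by
  choose f hf hb hP using h
  have hfm : ∀ i, Measurable fun x => ENNReal.ofReal (f i x) := fun i => (hf i).ennreal_ofReal
  have hsf : ∀ i, SigmaFinite ((Q i).withDensity fun x => ENNReal.ofReal (f i x)) :=
    fun i => hP i ▸ inferInstance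
  have hPQ : Measure.pi P =
      (Measure.pi Q).withDensity fun x => ∏ i, ENNReal.ofReal (f i (x i)) := by
    rw [← pi_withDensity Q hfm]
    congr 1
    exact funext hP
  have hm : Measurable fun x : ∀ i, Ω i => ∏ i, ENNReal.ofReal (f i (x i)) :=
    Finset.measurable_prod _ fun i _ => (hfm i).comp (measurable_pi_apply i)
  have hle : ∫⁻ x, ((Measure.pi P).rnDeriv (Measure.pi Q) x) ^ α ∂Measure.pi Q ≤
      ENNReal.ofReal (Real.exp ((α - 1) * (Fintype.card ι * (α * ε ^ 2 / 2)))) := by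
    calc _ = ∫⁻ x, ∏ i, ENNReal.ofReal (f i (x i)) ^ α ∂Measure.pi Q := by
          refine lintegral_congr_ae ?_
          rw [hPQ]
          filter_upwards [Measure.rnDeriv_withDensity (Measure.pi Q) hm] with x hx
          rw [hx, ENNReal.prod_rpow_of_nonneg (by linarith)]
      _ = ∏ i, ∫⁻ x, ENNReal.ofReal (f i x) ^ α ∂Q i :=
          lintegral_pi_prod Q fun i => (hfm i).pow_const α
      _ ≤ ∏ _i : ι, ENNReal.ofReal (Real.exp ((α - 1) * (α * ε ^ 2 / 2))) := by
          refine Finset.prod_le_prod' fun i _ =>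
            lintegral_rpow_le_of_mem_Icc hα (hε ⟨i⟩) (hf i) (hb i) ?_
          rw [← setLIntegral_univ, ← withDensity_apply _ .univ, ← hP i, measure_univ]
      _ = _ := by
          rw [Finset.prod_const, Finset.card_univ, ← ENNReal.ofReal_pow (Real.exp_pos _).le,
            ← Real.exp_nat_mul]
          congr 2
          ring
  have hac : Measure.pi P ≪ Measure.pi Q := hPQ ▸ withDensity_absolutelyContinuous _ _
  rw [renyiDiv, if_pos hac]
  have hα' : (0 : ℝ) < α - 1 := by linarith
  calc _ ≤ (((α - 1)⁻¹ : ℝ) : EReal) *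
        ENNReal.log (ENNReal.ofReal (Real.exp ((α - 1) * (Fintype.card ι * (α * ε ^ 2 / 2))))) :=
        mul_le_mul_of_nonneg_left (ENNReal.log_le_log hle)
          (EReal.coe_nonneg.2 (inv_nonneg.2 hα'.le))
    _ = _ := by
        rw [ENNReal.log_ofReal_of_pos (Real.exp_pos _), Real.log_exp, ← EReal.coe_mul,
          inv_mul_cancel_left₀ hα'.ne']

/-! ### The survival function of Laplace noise -/

/-- The probability that a Laplace variable of scale `1` exceeds `-t`. -/
def survival (t : ℝ) : ℝ := if t ≤ 0 then Real.exp t / 2 else 1 - Real.exp (-t) / 2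

lemma survival_of_nonpos {t : ℝ} (ht : t ≤ 0) : survival t = Real.exp t / 2 := if_pos ht

lemma survival_of_nonneg {t : ℝ} (ht : 0 ≤ t) : survival t = 1 - Real.exp (-t) / 2 := by
  rcases ht.eq_or_lt with rfl | h
  · simp [survival]; norm_num
  · exact if_neg h.not_ge

lemma one_sub_survival (t : ℝ) : 1 - survival t = survival (-t) := by
  rcases le_total t 0 with h | h
  · rw [survival_of_nonpos h, survival_of_nonneg (neg_nonneg.2 h), neg_neg]
  · rw [survival_of_nonneg h, survival_of_nonpos (neg_nonpos.2 h)]; ring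

lemma survival_pos (t : ℝ) : 0 < survival t := by
  rcases le_total t 0 with h | h
  · rw [survival_of_nonpos h]; positivity
  · rw [survival_of_nonneg h]
    have := Real.exp_le_one_iff.2 (neg_nonpos.2 h)
    linarith

lemma survival_lt_one (t : ℝ) : survival t < 1 := by
  linarith [one_sub_survival t, survival_pos (-t)]

lemma survival_mono : Monotone survival := by
  intro s t hst
  rcases le_total t 0 with ht | ht
  · rw [survival_of_nonpos ht, survival_of_nonpos (hst.trans ht)]
    gcongr
  · rw [survival_of_nonneg ht]
    rcases le_total s 0 with hs | hs
    · rw [survival_of_nonpos hs]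
      have h1 := Real.exp_le_one_iff.2 (neg_nonpos.2 ht)
      have h2 := Real.exp_le_one_iff.2 hs
      linarith
    · rw [survival_of_nonneg hs]
      gcongr

/-- The logarithm of `survival` is 1-Lipschitz. When `s` and `s + h` lie on opposite sides of 0 the
inequality reduces to `1 ≤ cosh (s + h)`. -/
lemma survival_add_le (s : ℝ) {h : ℝ} (hh : 0 ≤ h) :
    survival (s + h) ≤ Real.exp h * survival s := by
  rcases le_total (s + h) 0 with h1 | h1
  · rw [survival_of_nonpos h1, survival_of_nonpos (by linarith), Real.exp_add]
    exact le_of_eq (by ring)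
  · rw [survival_of_nonneg h1]
    rcases le_total s 0 with hs | hs
    · rw [survival_of_nonpos hs]
      have e1 : Real.exp h * (Real.exp s / 2) = Real.exp (s + h) / 2 := by
        rw [Real.exp_add]; ring
      have := Real.one_le_cosh (s + h)
      rw [Real.cosh_eq] at this
      linarith
    · rw [survival_of_nonneg hs, neg_add, Real.exp_add]
      have h2 : Real.exp (-s) ≤ 1 := Real.exp_le_one_iff.2 (neg_nonpos.2 hs)
      have h3 : 1 ≤ Real.exp h := Real.one_le_exp hh
      have h4 : Real.exp (-h) ≤ 1 := Real.exp_le_one_iff.2 (neg_nonpos.2 hh)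
      have h5 : Real.exp h * Real.exp (-h) = 1 := by rw [← Real.exp_add]; simp
      have h6 : 0 ≤ (1 - Real.exp (-s)) * (Real.exp h - Real.exp (-h)) :=
        mul_nonneg (by linarith) (by linarith)
      nlinarith [mul_nonneg (sub_nonneg.2 h3) (sub_nonneg.2 h4)]

lemma continuous_survival : Continuous survival := by
  refine Continuous.if_le (by fun_prop) (by fun_prop) continuous_id continuous_const ?_
  intro x hx
  rw [show x = 0 from hx]; norm_num

lemma laplace_Ioi {b : ℝ} (hb : 0 < b) (c : ℝ) :
    laplace b (Set.Ioi c) = ENNReal.ofReal (survival (-c / b)) := by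
  -- Only tails that do not cross the kink of the density at 0 are integrated; the case `c < 0`
  -- follows by complement.
  have key : ∀ c : ℝ, 0 ≤ c →
      laplace b (Set.Ioi c) = ENNReal.ofReal (survival (-c / b)) ∧
      laplace b (Set.Iic (-c)) = ENNReal.ofReal (survival (-c / b)) := by
    intro c hc
    have hs : survival (-c / b) = 1 / (2 * b) * (b * Real.exp (-c / b)) := by
      rw [survival_of_nonpos (div_nonpos_of_nonpos_of_nonneg (neg_nonpos.2 hc) hb.le)]
      field_simp
    rw [laplace, if_pos hb, withDensity_apply _ measurableSet_Ioi,
      withDensity_apply _ measurableSet_Iic, hs]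
    constructor
    · rw [setLIntegral_congr_fun (g := fun x => ENNReal.ofReal
        (1 / (2 * b) * Real.exp ((-1 / b) * x))) measurableSet_Ioi fun x hx => by
          rw [abs_of_pos (hc.trans_lt hx)]; congr 3; ring]
      rw [← ofReal_integral_eq_lintegral_ofReal
        ((integrableOn_exp_mul_Ioi (div_neg_of_neg_of_pos (by norm_num) hb) c).const_mul _)
        (Filter.Eventually.of_forall fun x => by positivity), integral_const_mul,
        integral_exp_mul_Ioi (div_neg_of_neg_of_pos (by norm_num) hb)]
      congr 2
      rw [show -1 / b * c = -c / b by ring]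
      field_simp
    · rw [setLIntegral_congr_fun (g := fun x => ENNReal.ofReal
        (1 / (2 * b) * Real.exp ((1 / b) * x))) measurableSet_Iic fun x hx => by
          rw [abs_of_nonpos (hx.trans (neg_nonpos.2 hc))]; congr 3; ring]
      rw [← ofReal_integral_eq_lintegral_ofReal
        ((integrableOn_exp_mul_Iic (by positivity : 0 < 1 / b) _).const_mul _)
        (Filter.Eventually.of_forall fun x => by positivity), integral_const_mul,
        integral_exp_mul_Iic (by positivity : 0 < 1 / b)]
      congr 2
      rw [show 1 / b * -c = -c / b by ring]
      field_simp
  rcases le_total 0 c with hc | hc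
  · exact (key c hc).1
  · have h := (key (-c) (neg_nonneg.2 hc)).2
    simp only [neg_neg] at h
    rw [← Set.compl_Iic, prob_compl_eq_one_sub measurableSet_Iic, h,
      ← ENNReal.ofReal_one,
      ← ENNReal.ofReal_sub _ (survival_pos _).le, one_sub_survival, neg_div]

lemma laplace_Iic {b : ℝ} (hb : 0 < b) (c : ℝ) :
    laplace b (Set.Iic c) = ENNReal.ofReal (1 - survival (-c / b)) := by
  rw [← Set.compl_Ioi, prob_compl_eq_one_sub measurableSet_Ioi, laplace_Ioi hb,
    ← ENNReal.ofReal_one, ← ENNReal.ofReal_sub _ (survival_pos _).le]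

/-! ### Total increment of the log-probabilities of splitting along a path -/

/-- A bound for the right derivative of `fun a => log (survival (max a (-log 2)))`. -/
def slopeBound (a : ℝ) : ℝ :=
  if a < -Real.log 2 then 0 else if a < 0 then 1 else Real.exp (-a)

lemma exists_hasDerivWithinAt_log_survival (a : ℝ) :
    ∃ g ≤ slopeBound a, HasDerivWithinAt
      (fun x => Real.log (survival (max x (-Real.log 2)))) g (Set.Ici a) a := by
  have hl : 0 < Real.log 2 := Real.log_pos (by norm_num)
  unfold slopeBound
  split_ifs with h1 h2
  · refine ⟨0, le_rfl, ?_⟩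
    refine ((hasDerivAt_const a (Real.log (survival (-Real.log 2)))).congr_of_eventuallyEq
      ?_).hasDerivWithinAt
    filter_upwards [Iio_mem_nhds h1] with x hx
    rw [max_eq_right hx.le]
  · refine ⟨1, le_rfl, ?_⟩
    refine ((hasDerivAt_id a).sub_const (Real.log 2)).hasDerivWithinAt.congr_of_eventuallyEq
      ?_ ?_
    · filter_upwards [self_mem_nhdsWithin, mem_nhdsWithin_of_mem_nhds (Iio_mem_nhds h2)]
        with x hx hx0
      rw [max_eq_left ((not_lt.1 h1).trans hx), survival_of_nonpos (le_of_lt hx0),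
        Real.log_div (Real.exp_ne_zero _) two_ne_zero, Real.log_exp, id]
    · rw [max_eq_left (not_lt.1 h1), survival_of_nonpos h2.le,
        Real.log_div (Real.exp_ne_zero _) two_ne_zero, Real.log_exp, id]
  · have h0 : 0 ≤ a := not_lt.1 h2
    have h3 : Real.exp (-a) ≤ 1 := Real.exp_le_one_iff.2 (neg_nonpos.2 h0)
    have h4 : (0 : ℝ) < 1 - Real.exp (-a) / 2 := by linarith
    refine ⟨Real.exp (-a) / 2 / (1 - Real.exp (-a) / 2), ?_, ?_⟩
    · rw [div_le_iff₀ h4]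
      nlinarith [Real.exp_pos (-a)]
    · have hd : HasDerivAt (fun x : ℝ => Real.log (1 - Real.exp (-x) / 2))
          (Real.exp (-a) / 2 / (1 - Real.exp (-a) / 2)) a := by
        have := (((hasDerivAt_neg a).exp.div_const 2).const_sub 1).log h4.ne'
        refine this.congr_deriv ?_
        congr 1; ring
      refine hd.hasDerivWithinAt.congr (fun x hx => ?_) ?_
      · rw [max_eq_left ((not_lt.1 h1).trans hx), survival_of_nonneg (h0.trans hx)]
      · rw [max_eq_left (not_lt.1 h1), survival_of_nonneg h0]

/-- Separation puts at most one point in each half-open interval of length `log 2`. The interval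
`[-log 2, 0)` contributes at most 1 and `[k log 2, (k + 1) log 2)` at most `2 ^ (-k)`. -/
lemma sum_slopeBound_le {β : Type*} (s : Finset β) (a : β → ℝ)
    (hsep : ∀ v ∈ s, ∀ w ∈ s, v ≠ w → Real.log 2 ≤ |a v - a w|) :
    ∑ v ∈ s, slopeBound (a v) ≤ 3 := by
  classical
  have hl : 0 < Real.log 2 := Real.log_pos (by norm_num)
  -- Index 0 is the interval `[-log 2, 0)`, and index `n ≥ 1` starts at `(n - 1) log 2`; points
  -- below `-log 2` have slope bound 0 and are dropped.
  set κ : ℕ → ℝ := fun n => if n = 0 then 1 else (1 / 2) ^ (n - 1) with hκ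
  set t := s.filter fun v => -Real.log 2 ≤ a v with ht
  set idx : β → ℕ := fun v => ⌊a v / Real.log 2 + 1⌋₊ with hidx
  have hnn : ∀ v ∈ t, 0 ≤ a v / Real.log 2 + 1 := by
    intro v hv
    have := (Finset.mem_filter.1 hv).2
    have : -1 ≤ a v / Real.log 2 := by rw [le_div_iff₀ hl]; linarith
    linarith
  have hinj : Set.InjOn idx t := by
    intro v hv w hw hvw
    by_contra hne
    have h1 := Nat.floor_le (hnn v hv)
    have h2 := Nat.lt_floor_add_one (a v / Real.log 2 + 1)
    have h3 := Nat.floor_le (hnn w hw)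
    have h4 := Nat.lt_floor_add_one (a w / Real.log 2 + 1)
    simp only [hidx] at hvw
    rw [hvw] at h1 h2
    have h5 := hsep v (Finset.mem_filter.1 hv).1 w (Finset.mem_filter.1 hw).1 hne
    have h6 : |a v / Real.log 2 - a w / Real.log 2| < 1 := by
      rw [abs_lt]; constructor <;> linarith
    rw [← sub_div, abs_div, abs_of_pos hl, div_lt_one hl] at h6
    linarith
  have hk : ∀ v ∈ t, slopeBound (a v) ≤ κ (idx v) := by
    intro v hv
    have hv' := (Finset.mem_filter.1 hv).2
    simp only [slopeBound, if_neg hv'.not_gt, hκ]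
    split_ifs with h1 h2 h2
    · exact le_rfl
    · refine absurd ?_ h2
      rw [hidx, Nat.floor_eq_zero]
      have := div_neg_of_neg_of_pos h1 hl
      linarith
    · exact Real.exp_le_one_iff.2 (by linarith)
    · have h3 := Nat.floor_le (hnn v hv)
      have h4 : ((idx v - 1 : ℕ) : ℝ) ≤ a v / Real.log 2 := by
        rw [Nat.cast_sub (Nat.one_le_iff_ne_zero.2 h2)]
        push_cast
        linarith
      rw [le_div_iff₀ hl] at h4
      have e : ((1 : ℝ) / 2) ^ (idx v - 1) = Real.exp (-((idx v - 1 : ℕ) * Real.log 2)) := by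
        rw [Real.exp_neg, Real.exp_nat_mul, Real.exp_log (by norm_num), one_div, inv_pow]
      rw [e]
      exact Real.exp_le_exp.2 (by linarith)
  calc ∑ v ∈ s, slopeBound (a v) = ∑ v ∈ t, slopeBound (a v) := by
        refine (Finset.sum_filter_of_ne fun v _ hv => ?_).symm
        by_contra h
        exact hv (if_pos (not_le.1 h))
    _ ≤ ∑ v ∈ t, κ (idx v) := Finset.sum_le_sum hk
    _ = ∑ n ∈ t.image idx, κ n := (Finset.sum_image hinj).symm
    _ ≤ ∑ n ∈ Finset.range ((t.image idx).sup id + 1), κ n := by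
        refine Finset.sum_le_sum_of_subset_of_nonneg (fun n hn => ?_) fun n _ _ => ?_
        · exact Finset.mem_range.2 (Nat.lt_succ_of_le (Finset.le_sup (f := id) hn))
        · simp only [hκ]; split_ifs <;> positivity
    _ ≤ 3 := by
        rw [Finset.sum_range_succ']
        simp only [hκ, if_neg (Nat.succ_ne_zero _), Nat.add_sub_cancel, if_true]
        linarith [sum_geometric_two_le ((t.image idx).sup id)]

/-- A common shift preserves the separation, so the sum has right derivative at most 3 throughout
the shift. Right derivatives are needed because of the kink at `-log 2`. -/
lemma sum_log_survival_add_sub_le {β : Type*} (s : Finset β) (a : β → ℝ)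
    (hsep : ∀ v ∈ s, ∀ w ∈ s, v ≠ w → Real.log 2 ≤ |a v - a w|) {h : ℝ} (hh : 0 ≤ h) :
    ∑ v ∈ s, (Real.log (survival (max (a v + h) (-Real.log 2))) -
      Real.log (survival (max (a v) (-Real.log 2)))) ≤ 3 * h := by
  choose g hg hgd using exists_hasDerivWithinAt_log_survival
  have hcont : Continuous fun x => Real.log (survival (max x (-Real.log 2))) :=
    (continuous_survival.comp (by fun_prop)).log fun x => (survival_pos _).ne'
  have key := image_le_of_deriv_right_le_deriv_boundary (a := 0) (b := h)
    (f := fun u => ∑ v ∈ s, Real.log (survival (max (a v + u) (-Real.log 2))))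
    (f' := fun u => ∑ v ∈ s, g (a v + u))
    (B := fun u => 3 * u + ∑ v ∈ s, Real.log (survival (max (a v) (-Real.log 2))))
    (B' := fun _ => 3)
    (Continuous.continuousOn
      (continuous_finsetSum s fun v _ => hcont.comp (continuous_const.add continuous_id)))
    (fun x _ => HasDerivWithinAt.fun_sum fun v _ => ?_) (by simp) (by fun_prop)
    (fun x _ => (((hasDerivAt_id x).const_mul 3).add_const _).hasDerivWithinAt.congr_deriv
      (mul_one 3))
    (fun x _ => (Finset.sum_le_sum fun v _ => hg _).trans
      (sum_slopeBound_le s (fun v => a v + x) fun v hv w hw hne => ?_))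
    (Set.right_mem_Icc.2 hh)
  · rw [Finset.sum_sub_distrib]
    linarith
  · have := (hgd (a v + x)).scomp x (s := Set.Ici x)
      (((hasDerivAt_id x).const_add (a v)).hasDerivWithinAt) fun y hy => by
        simpa using hy
    simpa [Function.comp_def] using this
  · simpa using hsep v hv w hw hne

/-! ### The law of the tree as a function of the biased counts -/

/-- Resampling one coordinate independently leaves a product law unchanged. This isolates the noise
at one node. -/
lemma map_update_prod_infinitePi {ι : Type*} [DecidableEq ι] {Ω : ι → Type*}
    [∀ i, MeasurableSpace (Ω i)] (μ : ∀ i, Measure (Ω i)) [∀ i, IsProbabilityMeasure (μ i)]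
    (v : ι) :
    ((Measure.infinitePi μ).prod (μ v)).map
      (fun p : (∀ i, Ω i) × Ω v => Function.update p.1 v p.2) = Measure.infinitePi μ := by
  have hm : Measurable fun p : (∀ i, Ω i) × Ω v => Function.update p.1 v p.2 :=
    measurable_update'
  refine Measure.eq_infinitePi μ fun s t ht => ?_
  rw [Measure.map_apply hm (MeasurableSet.pi s.countable_toSet fun i _ => ht i)]
  by_cases hv : v ∈ s
  · have : (fun p : (∀ i, Ω i) × Ω v => Function.update p.1 v p.2) ⁻¹' (s : Set ι).pi t =
        (((s.erase v : Finset ι) : Set ι).pi t) ×ˢ t v := by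
      ext p
      simp only [Set.mem_preimage, Set.mem_pi, Finset.mem_coe, Set.mem_prod, Finset.mem_erase]
      constructor
      · refine fun h => ⟨fun i hi => ?_, ?_⟩
        · simpa [Function.update_of_ne hi.1] using h i hi.2
        · simpa using h v hv
      · rintro ⟨h1, h2⟩ i hi
        by_cases hiv : i = v
        · subst hiv; simpa using h2
        · simpa [Function.update_of_ne hiv] using h1 i ⟨hiv, hi⟩
    rw [this, Measure.prod_prod, Measure.infinitePi_pi μ fun i _ => ht i,
      Finset.prod_erase_mul _ _ hv]
  · have : (fun p : (∀ i, Ω i) × Ω v => Function.update p.1 v p.2) ⁻¹' (s : Set ι).pi t =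
        ((s : Set ι).pi t) ×ˢ Set.univ := by
      ext p
      simp only [Set.mem_preimage, Set.mem_pi, Finset.mem_coe, Set.mem_prod, Set.mem_univ,
        and_true]
      refine forall₂_congr fun i hi => ?_
      rw [Function.update_of_ne (ne_of_mem_of_not_mem hi hv)]
    rw [this, Measure.prod_prod, Measure.infinitePi_pi μ fun i _ => ht i, measure_univ, mul_one]

lemma lintegral_infinitePi_update {ι : Type*} [DecidableEq ι] {Ω : ι → Type*}
    [∀ i, MeasurableSpace (Ω i)] (μ : ∀ i, Measure (Ω i)) [∀ i, IsProbabilityMeasure (μ i)]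
    (v : ι) {F : (∀ i, Ω i) → ENNReal} (hF : Measurable F) :
    ∫⁻ ω, F ω ∂Measure.infinitePi μ =
      ∫⁻ ω, ∫⁻ t, F (Function.update ω v t) ∂μ v ∂Measure.infinitePi μ := by
  have hm : Measurable fun p : (∀ i, Ω i) × Ω v => Function.update p.1 v p.2 :=
    measurable_update'
  conv_lhs => rw [← map_update_prod_infinitePi μ v]
  rw [lintegral_map hF hm]
  exact lintegral_prod _ (hF.comp hm).aemeasurable

/-- `v` is a node of the tree in which exactly the nodes with `d` are split. -/
def Reached (d : List Bool → Prop) : List Bool → Prop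
  | [] => True
  | _ :: v => Reached d v ∧ d v

/-- The tree in which exactly the nodes with `d` are split. -/
def decisionTree (d : List Bool → Prop) : Set (List Bool) := {v | Reached d v}

lemma cons_mem_decisionTree {d : List Bool → Prop} {c : Bool} {v : List Bool} :
    c :: v ∈ decisionTree d ↔ v ∈ decisionTree d ∧ d v := Iff.rfl

/-- Whether a node is reached depends only on decisions at its strict ancestors, which are shorter
lists. -/
lemma mem_decisionTree_update {d : List Bool → Prop} {v w : List Bool} {P : Prop}
    (h : w.length ≤ v.length) :
    w ∈ decisionTree (Function.update d v P) ↔ w ∈ decisionTree d := by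
  induction w with
  | nil => exact Iff.rfl
  | cons c w ih =>
    simp only [List.length_cons] at h
    rw [cons_mem_decisionTree, cons_mem_decisionTree, ih (by omega),
      Function.update_of_ne (fun e => by rw [e] at h; omega)]

lemma decisionTree_update_of_notMem {d : List Bool → Prop} {v : List Bool} (P : Prop)
    (h : v ∉ decisionTree d) :
    decisionTree (Function.update d v P) = decisionTree d := by
  ext w
  induction w with
  | nil => exact Iff.rfl
  | cons c w ih =>
    rw [cons_mem_decisionTree, cons_mem_decisionTree, ih]
    by_cases hw : w = v
    · subst hw; simp [h]
    · rw [Function.update_of_ne hw]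

/-- The tree for the biased counts `b` and given noise. -/
def noisyTree (θ : ℝ) (b noise : List Bool → ℝ) : Set (List Bool) :=
  decisionTree fun u => θ < b u + noise u

lemma treeOf_eq_noisyTree (lo hi δ θ : ℝ) (X : Multiset ℝ) :
    treeOf lo hi δ θ X = noisyTree θ (biasedCount lo hi δ θ X) := by
  ext noise v
  induction v with
  | nil => exact Iff.rfl
  | cons c v ih => exact and_congr_left' ih

lemma measurable_noisyTree (θ : ℝ) (b : List Bool → ℝ) : Measurable (noisyTree θ b) := by
  rw [measurable_set_iff]
  intro v
  induction v with
  | nil => exact measurable_const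
  | cons c v ih =>
    refine Measurable.and ih ?_
    refine measurableSet_setOfPred.1 (measurableSet_lt measurable_const ?_)
    fun_prop

lemma noisyTree_update (θ : ℝ) (b noise : List Bool → ℝ) (v : List Bool) (y t : ℝ) :
    noisyTree θ (Function.update b v y) (Function.update noise v t) =
      decisionTree (Function.update (fun u => θ < b u + noise u) v (θ < y + t)) := by
  unfold noisyTree
  congr 1
  ext u
  by_cases hu : u = v
  · subst hu; simp
  · simp [Function.update_of_ne hu]

/-- The law of the tree for the biased counts `b` and independent Laplace noise. -/
def treeLaw (lam θ : ℝ) (b : List Bool → ℝ) : Measure (Set (List Bool)) :=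
  (Measure.infinitePi fun _ : List Bool => laplace lam).map (noisyTree θ b)

/-- The probability that a node of biased count `y` is split. -/
def splitProb (lam θ y : ℝ) : ℝ := survival ((y - θ) / lam)

/-- The contribution of the node `v` to the likelihood ratio of the tree `T`, when the
probability that `v` is split changes from `p` to `q`. -/
def nodeRatio (v : List Bool) (p q : ℝ) (T : Set (List Bool)) : ℝ :=
  open Classical in
  if false :: v ∈ T then q / p else if v ∈ T then (1 - q) / (1 - p) else 1

lemma measurable_nodeRatio (v : List Bool) (p q : ℝ) : Measurable (nodeRatio v p q) := by
  unfold nodeRatio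
  exact Measurable.ite (measurableSet_setOfPred.2 (measurable_set_mem _)) measurable_const
    (Measurable.ite (measurableSet_setOfPred.2 (measurable_set_mem _)) measurable_const
      measurable_const)

lemma nodeRatio_nonneg {v : List Bool} {p q : ℝ} (hp : 0 ≤ p) (hp1 : p ≤ 1) (hq : 0 ≤ q)
    (hq1 : q ≤ 1) (T : Set (List Bool)) : 0 ≤ nodeRatio v p q T := by
  unfold nodeRatio
  split_ifs
  · positivity
  · exact div_nonneg (sub_nonneg.2 hq1) (sub_nonneg.2 hp1)
  · exact zero_le_one

lemma lintegral_laplace_comp_lt {lam : ℝ} (hlam : 0 < lam) (θ y : ℝ)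
    (F : Prop → ENNReal) :
    ∫⁻ t, F (θ < y + t) ∂laplace lam =
      F True * ENNReal.ofReal (splitProb lam θ y) +
        F False * ENNReal.ofReal (1 - splitProb lam θ y) := by
  have e : -(θ - y) / lam = (y - θ) / lam := by ring
  rw [← lintegral_add_compl _ (measurableSet_Ioi (a := θ - y)),
    setLIntegral_congr_fun (g := fun _ => F True) measurableSet_Ioi fun t ht => ?_,
    setLIntegral_congr_fun (g := fun _ => F False) measurableSet_Ioi.compl fun t ht => ?_,
    setLIntegral_const, setLIntegral_const, Set.compl_Ioi, laplace_Ioi hlam, laplace_Iic hlam,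
    e, splitProb]
  · have : ¬ θ < y + t := by
      simp only [Set.mem_compl_iff, Set.mem_Ioi, not_lt] at ht ⊢
      linarith
    simp only [this]
  · have : θ < y + t := by
      simp only [Set.mem_Ioi] at ht
      linarith
    simp only [this]

/-- With the other noises fixed, the decision at `v` is a Bernoulli variable whose parameter changes
from `p` to `q`. Both laws are compared after resampling the noise at `v`. -/
lemma treeLaw_update {lam : ℝ} (hlam : 0 < lam) (θ : ℝ) (b : List Bool → ℝ) (v : List Bool)
    (y : ℝ) :
    treeLaw lam θ (Function.update b v y) = (treeLaw lam θ b).withDensity fun T =>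
      ENNReal.ofReal (nodeRatio v (splitProb lam θ (b v)) (splitProb lam θ y) T) := by
  classical
  set p := splitProb lam θ (b v) with hp
  set q := splitProb lam θ y with hq
  have hp0 : 0 < p := survival_pos _
  have hp1 : p < 1 := survival_lt_one _
  have hq0 : 0 < q := survival_pos _
  have hq1 : q < 1 := survival_lt_one _
  have hg : Measurable fun T => ENNReal.ofReal (nodeRatio v p q T) :=
    (measurable_nodeRatio v p q).ennreal_ofReal
  ext A hA
  have hA1 : Measurable (A.indicator (1 : Set (List Bool) → ENNReal)) :=
    measurable_one.indicator hA
  rw [withDensity_apply _ hA, ← lintegral_indicator hA, ← lintegral_indicator_one hA, treeLaw,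
    treeLaw, lintegral_map hA1 (measurable_noisyTree _ _),
    lintegral_map (hg.indicator hA) (measurable_noisyTree _ _)]
  refine (lintegral_infinitePi_update _ v (hA1.comp (measurable_noisyTree _ _))).trans
    (Eq.trans (lintegral_congr fun noise => ?_) (lintegral_infinitePi_update _ v
      ((hg.indicator hA).comp (measurable_noisyTree _ _))).symm)
  simp only [Function.comp_apply]
  set d : List Bool → Prop := fun u => θ < b u + noise u
  have hb : ∀ t, noisyTree θ b (Function.update noise v t) =
      decisionTree (Function.update d v (θ < b v + t)) := fun t => by
    rw [← noisyTree_update, Function.update_eq_self]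
  simp only [noisyTree_update, hb]
  rw [lintegral_laplace_comp_lt hlam θ y
      fun P => A.indicator 1 (decisionTree (Function.update d v P)),
    lintegral_laplace_comp_lt hlam θ (b v) fun P => A.indicator
      (fun T => ENNReal.ofReal (nodeRatio v p q T)) (decisionTree (Function.update d v P)),
    ← hp, ← hq]
  -- If `v` is reached, `nodeRatio` reweights its two outcomes; if not, the tree ignores the
  -- decision at `v` and the ratio is 1.
  by_cases hv : v ∈ decisionTree d
  · have hvP : ∀ P, v ∈ decisionTree (Function.update d v P) := fun P =>
      (mem_decisionTree_update le_rfl).2 hv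
    have h1 : nodeRatio v p q (decisionTree (Function.update d v True)) = q / p :=
      if_pos (cons_mem_decisionTree.2 ⟨hvP _, by simp⟩)
    have h0 : nodeRatio v p q (decisionTree (Function.update d v False)) =
        (1 - q) / (1 - p) := by
      rw [nodeRatio, if_neg fun h => by simpa using (cons_mem_decisionTree.1 h).2,
        if_pos (hvP _)]
    have e1 : ENNReal.ofReal (q / p) * ENNReal.ofReal p = ENNReal.ofReal q := by
      rw [← ENNReal.ofReal_mul (by positivity), div_mul_cancel₀ _ hp0.ne']
    have e0 : ENNReal.ofReal ((1 - q) / (1 - p)) * ENNReal.ofReal (1 - p) =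
        ENNReal.ofReal (1 - q) := by
      rw [← ENNReal.ofReal_mul (div_nonneg (by linarith) (by linarith)),
        div_mul_cancel₀ _ (by linarith)]
    simp only [Set.indicator_apply, h1, h0, Pi.one_apply, ite_mul, zero_mul, one_mul, e1, e0]
  · have hn : nodeRatio v p q (decisionTree d) = 1 := by
      rw [nodeRatio, if_neg fun h => hv (cons_mem_decisionTree.1 h).1, if_neg hv]
    simp only [decisionTree_update_of_notMem _ hv, Set.indicator_apply, hn, ENNReal.ofReal_one,
      Pi.one_apply]
    rw [← mul_add, ← mul_add, ← ENNReal.ofReal_add hq0.le (by linarith),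
      ← ENNReal.ofReal_add hp0.le (by linarith)]
    simp

lemma treeLaw_piecewise {lam : ℝ} (hlam : 0 < lam) (θ : ℝ) (b b' : List Bool → ℝ)
    (S : Finset (List Bool)) :
    treeLaw lam θ (S.piecewise b' b) = (treeLaw lam θ b).withDensity fun T =>
      ENNReal.ofReal (∏ v ∈ S, nodeRatio v (splitProb lam θ (b v)) (splitProb lam θ (b' v)) T) := by
  induction S using Finset.induction_on with
  | empty => simp
  | insert a S ha ih =>
    rw [Finset.piecewise_insert, treeLaw_update hlam, ih,
      ← withDensity_mul _ (Finset.measurable_prod S fun v _ =>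
        measurable_nodeRatio v _ _).ennreal_ofReal (measurable_nodeRatio a _ _).ennreal_ofReal]
    congr 1
    ext T
    have h0 : 0 ≤ ∏ v ∈ S, nodeRatio v (splitProb lam θ (b v)) (splitProb lam θ (b' v)) T :=
      Finset.prod_nonneg fun v _ => nodeRatio_nonneg (survival_pos _).le (survival_lt_one _).le
        (survival_pos _).le (survival_lt_one _).le T
    rw [Pi.mul_apply, ← ENNReal.ofReal_mul h0, Finset.prod_insert ha, mul_comm,
      Finset.piecewise_eq_of_notMem _ _ _ ha]

/-- The outcome space contains arbitrary sets of nodes; this restricts attention to genuine trees,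
where the lower child alone shows whether a node was split. -/
lemma ae_treeLaw_isTree (lam θ : ℝ) (b : List Bool → ℝ) :
    ∀ᵐ T ∂treeLaw lam θ b, ∀ c v, c :: v ∈ T → v ∈ T ∧ false :: v ∈ T := by
  simp only [ae_all_iff]
  intro c v
  rw [treeLaw, ae_map_iff (measurable_noisyTree _ _).aemeasurable]
  · exact Filter.Eventually.of_forall fun noise h => ⟨h.1, h⟩
  · exact measurableSet_setOfPred.2 ((measurable_set_mem _).imp
      ((measurable_set_mem _).and (measurable_set_mem _)))

/-! ### The likelihood ratio of a path -/

lemma false_cons_mem_of_isSuffix {T : Set (List Bool)}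
    (hT : ∀ c v, c :: v ∈ T → v ∈ T ∧ false :: v ∈ T)
    {v w : List Bool} (h : v <:+ w) (hne : v ≠ w) (hw : w ∈ T) : false :: v ∈ T := by
  induction w with
  | nil => exact absurd (List.suffix_nil.1 h) hne
  | cons c w ih =>
    rcases List.suffix_cons_iff.1 h with rfl | h
    · exact absurd rfl hne
    · by_cases e : v = w
      · subst e; exact (hT c v hw).2
      · exact ih h e (hT c w hw).1

lemma prod_nodeRatio_mem_Icc {S : Finset (List Bool)} {p q : List Bool → ℝ} {h C : ℝ}
    (hchain : ∀ v ∈ S, ∀ w ∈ S, v <:+ w ∨ w <:+ v) (hp : ∀ v ∈ S, 0 < p v)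
    (hq : ∀ v ∈ S, q v < 1) (hpq : ∀ v ∈ S, p v ≤ q v)
    (hleaf : ∀ v ∈ S, 1 - p v ≤ Real.exp h * (1 - q v)) (hh : 0 ≤ h) (hhC : h ≤ C)
    (hsum : ∑ v ∈ S, (Real.log (q v) - Real.log (p v)) ≤ C) {T : Set (List Bool)}
    (hT : ∀ c v, c :: v ∈ T → v ∈ T ∧ false :: v ∈ T) :
    ∏ v ∈ S, nodeRatio v (p v) (q v) T ∈ Set.Icc (Real.exp (-C)) (Real.exp C) := by
  classical
  have hone : ∀ v ∈ S, 1 ≤ q v / p v := fun v hv => (one_le_div (hp v hv)).2 (hpq v hv)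
  have hp1 : ∀ v ∈ S, 0 < 1 - p v := fun v hv => by linarith [hq v hv, hpq v hv]
  have hnn : ∀ v ∈ S, 0 ≤ nodeRatio v (p v) (q v) T := fun v hv =>
    nodeRatio_nonneg (hp v hv).le (by linarith [hp1 v hv])
      ((hp v hv).le.trans (hpq v hv)) (hq v hv).le T
  have hprod : ∀ s : Finset (List Bool), (∀ v ∈ s, 1 ≤ nodeRatio v (p v) (q v) T) →
      1 ≤ ∏ v ∈ s, nodeRatio v (p v) (q v) T := fun s h => by
    simpa using Finset.prod_le_prod (fun _ _ => zero_le_one) h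
  constructor
  · have hge : ∀ v ∈ S, (v ∈ T → false :: v ∈ T) → 1 ≤ nodeRatio v (p v) (q v) T := by
      intro v hv hvT
      unfold nodeRatio
      split_ifs with h1 h2
      · exact hone v hv
      · exact absurd (hvT h2) h1
      · exact le_rfl
    refine (Real.exp_le_exp.2 (neg_le_neg hhC)).trans ?_
    -- At most one node of the chain is a leaf of `T`: its ancestors are split and its descendants
    -- are absent. All other factors are at least 1.
    by_cases hex : ∃ v ∈ S, v ∈ T ∧ false :: v ∉ T
    · obtain ⟨v, hv, hvT, hvl⟩ := hex
      rw [← Finset.mul_prod_erase S _ hv]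
      have h1 : Real.exp (-h) ≤ nodeRatio v (p v) (q v) T := by
        rw [nodeRatio, if_neg hvl, if_pos hvT, le_div_iff₀ (hp1 v hv), Real.exp_neg,
          inv_mul_le_iff₀ (Real.exp_pos h)]
        exact hleaf v hv
      have h2 : 1 ≤ ∏ w ∈ S.erase v, nodeRatio w (p w) (q w) T := by
        refine hprod _ fun w hw => ?_
        obtain ⟨hne, hw⟩ := Finset.mem_erase.1 hw
        refine hge w hw fun hwT => ?_
        rcases hchain v hv w hw with hs | hs
        · exact absurd (false_cons_mem_of_isSuffix hT hs hne.symm hwT) hvl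
        · exact false_cons_mem_of_isSuffix hT hs hne hvT
      exact h1.trans (le_mul_of_one_le_right (hnn v hv) h2)
    · push Not at hex
      exact (Real.exp_le_one_iff.2 (neg_nonpos.2 hh)).trans
        (hprod S fun v hv => hge v hv (hex v hv))
  · calc ∏ v ∈ S, nodeRatio v (p v) (q v) T ≤ ∏ v ∈ S, q v / p v := by
          refine Finset.prod_le_prod hnn fun v hv => ?_
          unfold nodeRatio
          split_ifs
          · exact le_rfl
          · exact ((div_le_one (hp1 v hv)).2 (by linarith [hpq v hv])).trans (hone v hv)
          · exact hone v hv
      _ = Real.exp (∑ v ∈ S, (Real.log (q v) - Real.log (p v))) := by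
          rw [Real.exp_sum]
          refine Finset.prod_congr rfl fun v hv => ?_
          rw [Real.exp_sub, Real.exp_log (hp v hv),
            Real.exp_log ((hp v hv).trans_le (hpq v hv))]
      _ ≤ Real.exp C := Real.exp_le_exp.2 hsum

/-! ### Adding a value to the data of PrivTree -/

lemma cell_cons_subset (lo hi : ℝ) (c : Bool) (v : List Bool) :
    cell lo hi (c :: v) ⊆ cell lo hi v := by
  cases c <;> exact Set.inter_subset_left

lemma cell_anti_of_isSuffix {lo hi : ℝ} {v w : List Bool} (h : v <:+ w) :
    cell lo hi w ⊆ cell lo hi v := by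
  induction w with
  | nil => rw [List.suffix_nil.1 h]
  | cons c w ih =>
    rcases List.suffix_cons_iff.1 h with rfl | h
    · exact subset_rfl
    · exact (cell_cons_subset lo hi c w).trans (ih h)

/-- The half-open bisection makes sibling cells disjoint, so a point lies in at most one cell of
each depth. -/
lemma eq_of_mem_cell {lo hi x : ℝ} {v w : List Bool} (hv : x ∈ cell lo hi v)
    (hw : x ∈ cell lo hi w) (hl : v.length = w.length) : v = w := by
  induction v generalizing w with
  | nil => exact (List.length_eq_zero_iff.1 hl.symm).symm
  | cons c v ih =>
    cases w with
    | nil => simp at hl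
    | cons c' w =>
      obtain rfl := ih (cell_cons_subset _ _ _ _ hv) (cell_cons_subset _ _ _ _ hw)
        (by simpa using hl)
      cases c <;> cases c'
      · rfl
      · exact absurd (Set.mem_Iio.1 hv.2) (not_lt.2 (Set.mem_Ici.1 hw.2))
      · exact absurd (Set.mem_Iio.1 hw.2) (not_lt.2 (Set.mem_Ici.1 hv.2))
      · rfl

lemma isSuffix_of_mem_cell {lo hi x : ℝ} {v w : List Bool} (hv : x ∈ cell lo hi v)
    (hw : x ∈ cell lo hi w) (hl : v.length ≤ w.length) : v <:+ w := by
  have h : w.drop (w.length - v.length) <:+ w := List.drop_suffix _ _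
  rwa [← eq_of_mem_cell hv (cell_anti_of_isSuffix h hw) (by simp; omega)] at h

lemma count_anti_of_isSuffix {lo hi : ℝ} (X : Multiset ℝ) {v w : List Bool} (h : v <:+ w) :
    count lo hi X w ≤ count lo hi X v := by
  classical
  unfold count
  rw [Multiset.countP_eq_card_filter, Multiset.countP_eq_card_filter]
  exact Multiset.card_le_card
    (Multiset.monotone_filter_right X fun x hx => cell_anti_of_isSuffix h hx)

lemma count_cons_of_mem {lo hi x : ℝ} (X : Multiset ℝ) {v : List Bool}
    (h : x ∈ cell lo hi v) : count lo hi (x ::ₘ X) v = count lo hi X v + 1 := by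
  classical
  exact Multiset.countP_cons_of_pos X h

lemma count_cons_of_notMem {lo hi x : ℝ} (X : Multiset ℝ) {v : List Bool}
    (h : x ∉ cell lo hi v) : count lo hi (x ::ₘ X) v = count lo hi X v := by
  classical
  exact Multiset.countP_cons_of_neg X h

lemma biasedCount_of_card_le {lo hi δ θ : ℝ} {X : Multiset ℝ} {v : List Bool}
    (h : (X.card : ℝ) - v.length * δ ≤ θ - δ) : biasedCount lo hi δ θ X v = θ - δ := by
  classical
  refine max_eq_right (le_trans ?_ h)
  have : (count lo hi X v : ℝ) ≤ X.card := Nat.cast_le.2 (Multiset.countP_le_card _ X)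
  linarith

/-- In units of the noise scale, the floor `θ - δ` sits at distance `log 2` below the threshold. -/
lemma splitProb_max {lam θ : ℝ} (hlam : 0 < lam) (c : ℝ) :
    splitProb lam θ (max c (θ - lam * Real.log 2)) =
      survival (max ((c - θ) / lam) (-Real.log 2)) := by
  have e : -Real.log 2 = (θ - lam * Real.log 2 - θ) / lam := by field_simp; ring
  rw [splitProb, e, ← max_sub_sub_right, max_div_div_right hlam.le]

/-- PrivTree with noise scale `lam` and decay `lam * log 2` is `3 / lam`-differentially private. -/
lemma hasBoundedRatio_privTree_cons (lo hi : ℝ) {lam : ℝ} (hlam : 0 < lam) (θ x : ℝ)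
    (X : Multiset ℝ) :
    HasBoundedRatio (3 / lam) (privTree lo hi lam (lam * Real.log 2) θ (x ::ₘ X))
      (privTree lo hi lam (lam * Real.log 2) θ X) := by
  classical
  have hl : 0 < Real.log 2 := Real.log_pos (by norm_num)
  set δ := lam * Real.log 2 with hδ
  have hδ0 : 0 < δ := mul_pos hlam hl
  -- From depth `N` on, both biased counts equal the floor `θ - δ`, so only finitely many nodes
  -- change; the `+ 1` accounts for the added value.
  obtain ⟨N, hN⟩ := exists_nat_gt (((X.card : ℝ) + 1 - θ + δ) / δ)
  rw [div_lt_iff₀ hδ0] at hN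
  set S : Finset (List Bool) :=
    (List.finite_length_lt Bool N).toFinset.filter fun v => x ∈ cell lo hi v with hS
  have hmem : ∀ v ∈ S, x ∈ cell lo hi v := fun v hv => (Finset.mem_filter.1 hv).2
  set b := biasedCount lo hi δ θ X with hb
  set b' := biasedCount lo hi δ θ (x ::ₘ X) with hb'
  have hbb : b' = S.piecewise b' b := by
    ext v
    by_cases hv : v ∈ S
    · rw [Finset.piecewise_eq_of_mem _ _ _ hv]
    · rw [Finset.piecewise_eq_of_notMem _ _ _ hv]
      by_cases hx : x ∈ cell lo hi v
      · have hlen : (N : ℝ) ≤ v.length := by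
          simp only [hS, Finset.mem_filter, Set.Finite.mem_toFinset, Set.mem_ofPred_eq, hx,
            and_true, not_lt] at hv
          exact_mod_cast hv
        have := mul_le_mul_of_nonneg_right hlen hδ0.le
        rw [hb, hb', biasedCount_of_card_le, biasedCount_of_card_le]
        · linarith
        · rw [Multiset.card_cons]; push_cast; linarith
      · rw [hb, hb', biasedCount, biasedCount, count_cons_of_notMem X hx]
  have hlaw : ∀ Y, privTree lo hi lam δ θ Y = treeLaw lam θ (biasedCount lo hi δ θ Y) :=
    fun Y => by rw [privTree, treeOf_eq_noisyTree, treeLaw]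
  set a : List Bool → ℝ := fun v => ((count lo hi X v : ℝ) - v.length * δ - θ) / lam with ha
  have hp : ∀ v, splitProb lam θ (b v) = survival (max (a v) (-Real.log 2)) := fun v =>
    splitProb_max hlam _
  have hq : ∀ v ∈ S, splitProb lam θ (b' v) =
      survival (max (a v + 1 / lam) (-Real.log 2)) := fun v hv => by
    rw [hb', biasedCount, splitProb_max hlam, count_cons_of_mem X (hmem v hv), ha, ← add_div]
    congr 3
    push_cast
    ring
  have h1 : 0 ≤ 1 / lam := by positivity
  -- Deeper in the chain the count cannot grow and the depth penalty gains at least `δ = lam * log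
  -- 2`.
  have hsep : ∀ v ∈ S, ∀ w ∈ S, v.length < w.length → Real.log 2 ≤ a v - a w := by
    intro v hv w hw hlt
    have hc : (count lo hi X w : ℝ) ≤ count lo hi X v := Nat.cast_le.2
      (count_anti_of_isSuffix X (isSuffix_of_mem_cell (hmem v hv) (hmem w hw) hlt.le))
    have hlen : (v.length : ℝ) + 1 ≤ w.length := by exact_mod_cast hlt
    have := mul_le_mul_of_nonneg_right hlen hδ0.le
    rw [ha, ← sub_div, le_div_iff₀ hlam]
    linarith
  refine ⟨fun T => ∏ v ∈ S, nodeRatio v (splitProb lam θ (b v)) (splitProb lam θ (b' v)) T,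
    Finset.measurable_prod S fun v _ => measurable_nodeRatio v _ _, ?_, ?_⟩
  · rw [hlaw]
    filter_upwards [ae_treeLaw_isTree lam θ b] with T hT
    refine prod_nodeRatio_mem_Icc (p := fun v => splitProb lam θ (b v))
      (q := fun v => splitProb lam θ (b' v)) (h := 1 / lam) (fun v hv w hw => ?_)
      (fun v _ => survival_pos _) (fun v _ => survival_lt_one _) (fun v hv => ?_)
      (fun v hv => ?_) h1 (by gcongr; norm_num) ?_ hT
    · exact (le_total v.length w.length).imp (isSuffix_of_mem_cell (hmem v hv) (hmem w hw))
        (isSuffix_of_mem_cell (hmem w hw) (hmem v hv))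
    · simp only [hp, hq v hv]
      exact survival_mono (max_le_max_right _ (by linarith))
    · simp only [hp, hq v hv]
      rw [one_sub_survival, one_sub_survival]
      refine le_trans (survival_mono ?_) (survival_add_le _ h1)
      -- Truncation from below does not enlarge the shift.
      have : max (a v + 1 / lam) (-Real.log 2) ≤ max (a v) (-Real.log 2) + 1 / lam :=
        max_le (by linarith [le_max_left (a v) (-Real.log 2)])
          (by linarith [le_max_right (a v) (-Real.log 2)])
      linarith
    · rw [Finset.sum_congr rfl fun v hv => by rw [hp, hq v hv]]
      refine (sum_log_survival_add_sub_le S a (fun v hv w hw hne => ?_) h1).trans_eq (by ring)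
      rcases lt_trichotomy v.length w.length with hlt | heq | hlt
      · exact (hsep v hv w hw hlt).trans (le_abs_self _)
      · exact absurd (eq_of_mem_cell (hmem v hv) (hmem w hw) heq) hne
      · rw [abs_sub_comm]
        exact (hsep w hw v hv hlt).trans (le_abs_self _)
  · rw [hlaw, hlaw, ← hb', ← hb]
    conv_lhs => rw [hbb]
    exact treeLaw_piecewise hlam θ b b' S

/-! ### PrivTree Binning -/

lemma noiseScale_eq {ι : Type u} {κ : Type v} [Fintype ι] (S : Schema.{u, v, w} ι κ) (β : ℕ)
    (ρ₁ : ℝ) : noiseScale S β ρ₁ = 3 * √(((largeNum S β).card : ℝ) / (2 * ρ₁)) := by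
  rw [noiseScale, beta0]
  norm_num

lemma hasBoundedRatio_privTree_column {ι : Type u} {κ : Type v} {S : Schema.{u, v, w} ι κ}
    {lam : ℝ} (hlam : 0 < lam) (θ : ℝ) {D D' : Dataset S} (h : Neighbor D D') (j : ι) :
    HasBoundedRatio (3 / lam)
      (privTree (S.lo j) (S.hi j) lam (lam * Real.log 2) θ (column D j))
      (privTree (S.lo j) (S.hi j) lam (lam * Real.log 2) θ (column D' j)) := by
  obtain ⟨r, rfl | rfl⟩ := h
  · rw [column, column, Multiset.map_cons]
    exact (hasBoundedRatio_privTree_cons _ _ hlam θ _ _).symm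
  · rw [column, column, Multiset.map_cons]
    exact hasBoundedRatio_privTree_cons _ _ hlam θ _ _

end PrivTreeBinning

end

theorem mainTheorem2 {ι : Type u} {κ : Type v} [Fintype ι]
    (S : PrivTreeBinning.Schema.{u, v, w} ι κ) (β : ℕ) (θ ρ₁ : ℝ) (hρ₁ : 0 < ρ₁)
    (α : ℝ) (hα : 1 < α) :
    PrivTreeBinning.IsRDP (PrivTreeBinning.privTreeBinning S β θ ρ₁) α (α * ρ₁) := by
  intro D D' hD
  set lam := PrivTreeBinning.noiseScale S β ρ₁ with hlam
  -- If `V_n` is empty, the noise scale is 0; positivity is then not needed, since the product of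
  -- releases is empty.
  have hpos : Nonempty (PrivTreeBinning.largeNum S β) → 0 < lam := by
    rintro ⟨j⟩
    have hcard : 0 < (PrivTreeBinning.largeNum S β).card := Finset.card_pos.2 ⟨j, j.2⟩
    rw [hlam, PrivTreeBinning.noiseScale_eq]
    positivity
  refine (PrivTreeBinning.renyiDiv_pi_le _ _ hα (ε := 3 / lam)
    (fun h => div_pos three_pos (hpos h)) fun j =>
      PrivTreeBinning.hasBoundedRatio_privTree_column (hpos ⟨j⟩) θ hD j).trans ?_
  rw [EReal.coe_le_coe_iff, Fintype.card_coe]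
  rcases (PrivTreeBinning.largeNum S β).card.eq_zero_or_pos with h0 | h0
  · rw [h0, Nat.cast_zero, zero_mul]
    positivity
  · have hc : (0 : ℝ) < (PrivTreeBinning.largeNum S β).card := Nat.cast_pos.2 h0
    rw [hlam, PrivTreeBinning.noiseScale_eq, div_pow, mul_pow, Real.sq_sqrt (by positivity)]
    refine le_of_eq ?_
    field_simp
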